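/- Let $P$ be a finite poset and let $c>\tfrac12$ be a real number. For a family $\mathcal A$ of subsets of $[n]=\{1,\dots,n\}$ let $l_n(\mathcal A)=\sum_{A\in\mathcal A}\binom{n}{|A|}^{-1}$ be its Lubell function. Call $\mathcal A$ induced $P$-free if there is no injection $\varphi:P\to\mathcal A$ such that, for all $x,y\in P$, $x\le y$ if and only if $\varphi(x)\subseteq\varphi(y)$. Let $\lambda^\#_n(P)$ be the maximum of $l_n(\mathcal A)$ over all induced $P$-free families $\mathcal A\subseteq 2^{[n]}$ (read as $0$ if $P$ is empty, when there is no such family). Then $$\lambda^\#_n(P)=\mathcal O(n^c)\qquad(n\to\infty).$$ Moreover, there is a constant $C$, depending only on $P$ and $c$, such that for all integers $0\le a<b\le n$ and every induced $P$-free family $\mathcal A\subseteq 2^{[n]}$ all of whose members have cardinality between $a$ and $b$ (inclusive), $$l_n(\mathcal A)\le C\,(b-a)^c.$$ -/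

import Mathlib

open Filter Asymptotics

/-- `P` is an induced subposet of the family `A` of subsets of `{0, …, n-1}`, ordered by inclusion:
some injection `φ : P → A` satisfies `x ≤ y ↔ φ x ⊆ φ y`. -/
def IsInducedSubposet (P : Type*) [PartialOrder P] {n : ℕ} (A : Finset (Finset (Fin n))) : Prop :=
  ∃ φ : P → Finset (Fin n), Function.Injective φ ∧ (∀ x, φ x ∈ A) ∧
    ∀ x y, x ≤ y ↔ φ x ⊆ φ y

/-- `A` is induced `P`-free. -/
def InducedFree (P : Type*) [PartialOrder P] {n : ℕ} (A : Finset (Finset (Fin n))) : Prop :=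
  ¬ IsInducedSubposet P A

/-- The Lubell function `l_n(A) = ∑_{S ∈ A} 1 / (n choose |S|)`. -/
noncomputable def lubell {n : ℕ} (A : Finset (Finset (Fin n))) : ℝ :=
  ∑ S ∈ A, 1 / (n.choose S.card : ℝ)

/-- `λ^#_n(P)`: the largest value of the Lubell function over all induced `P`-free families of
subsets of an `n`-element set. For nonempty `P` it is attained (see `lubellMax_isGreatest`). -/
noncomputable def lubellMax (n : ℕ) (P : Type*) [PartialOrder P] : ℝ :=
  sSup {x : ℝ | ∃ A : Finset (Finset (Fin n)), InducedFree P A ∧ lubell A = x}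

/-- For a nonempty poset the supremum defining `lubellMax` is a maximum. -/
theorem lubellMax_isGreatest (n : ℕ) (P : Type*) [PartialOrder P] [Nonempty P] :
    IsGreatest {x : ℝ | ∃ A : Finset (Finset (Fin n)), InducedFree P A ∧ lubell A = x}
      (lubellMax n P) := by
  have hne : {x : ℝ | ∃ A : Finset (Finset (Fin n)), InducedFree P A ∧ lubell A = x}.Nonempty := by
    refine ⟨_, ∅, ?_, rfl⟩
    rintro ⟨φ, -, h, -⟩
    simpa using h (Classical.arbitrary P)
  have hfin : {x : ℝ | ∃ A : Finset (Finset (Fin n)), InducedFree P A ∧ lubell A = x}.Finite :=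
    (Set.toFinite {A : Finset (Finset (Fin n)) | InducedFree P A}).image lubell
  exact ⟨hne.csSup_mem hfin, fun x hx => le_csSup hfin.bddAbove hx⟩

/-! Realize `P` by `d + 1` strictly monotone coordinates. The sets `gridSet` embed a `(d +
1)`-dimensional grid in the Boolean lattice, preserving and reflecting order, so the grid points
whose permuted sets lie in an induced `P`-free family avoid the realizer as a pattern.
Multidimensional Marcus–Tardos (`card_le_of_not_containsPattern`) leaves only `O(u ^ d)` such points
when the side is `O(u)`. Averaged over all permutations, the number of grid points hitting the
family is `u ^ d` times its Lubell function, provided each of the `u + 1` levels carries `u ^ d`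
grid points. So such a window contributes `O(1)` (`exists_lubell_le_of_window`).

With `u = ⌊√(b - a)⌋`, the levels from `a` to `b` meet `O(u)` windows, and the `O(u)` levels too
near the bottom or top cost at most 1 each. This gives exponent 1/2, hence every `c > 1/2`. -/

/-! ### Pattern avoidance in grids: the Marcus–Tardos theorem -/

/-- `M` contains the pattern given by the coordinate functions `σ`: some points of `M` indexed by `P`
are ordered in each coordinate as `σ` prescribes. -/
def ContainsPattern {ι P : Type*} (σ : ι → P → ℕ) (M : Finset (ι → ℕ)) : Prop :=
  ∃ φ : P → ι → ℕ, (∀ x, φ x ∈ M) ∧ ∀ i x y, σ i x < σ i y → φ x i < φ y i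

theorem exists_order_preserving_map_into_finset {P : Type*} [Fintype P] (τ : P → ℕ) (S : Finset ℕ)
    (hS : Fintype.card P ≤ S.card) :
    ∃ g : P → ℕ, (∀ x, g x ∈ S) ∧ ∀ x y, τ x < τ y → g x < g y := by
  classical
  have hr : ∀ x, (Finset.univ.filter fun y => τ y < τ x).card < S.card := fun x =>
    lt_of_lt_of_le (Finset.card_lt_univ_of_notMem (x := x) (by simp)) hS
  refine ⟨fun x => S.orderEmbOfFin rfl ⟨_, hr x⟩, fun x => Finset.orderEmbOfFin_mem _ _ _, ?_⟩
  intro x y hxy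
  refine (S.orderEmbOfFin rfl).strictMono ?_
  refine Fin.mk_lt_mk.2 (Finset.card_lt_card ?_)
  rw [Finset.ssubset_iff_of_subset]
  · exact ⟨x, by simpa using hxy, by simp⟩
  · intro z hz
    simp only [Finset.mem_filter, Finset.mem_univ, true_and] at hz ⊢
    omega

theorem ContainsPattern.of_image_div {ι P : Type*} [DecidableEq (ι → ℕ)] {σ : ι → P → ℕ}
    {M : Finset (ι → ℕ)} {s : ℕ}
    (h : ContainsPattern σ (M.image fun p i => p i / s)) : ContainsPattern σ M := by
  obtain ⟨φ, hφ, hlt⟩ := h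
  have := fun x => Finset.mem_image.1 (hφ x)
  choose ψ hψ hψφ using this
  refine ⟨ψ, hψ, fun i x y hxy => ?_⟩
  have h1 := hlt i x y hxy
  rw [← hψφ x, ← hψφ y] at h1
  exact lt_of_not_ge fun hle => absurd (Nat.div_le_div_right (c := s) hle) (not_le.2 h1)

/-- The blocks of side `s` whose `i`-th coordinate is `j` and which meet `M` in points with every
`i`-th coordinate in `S`. -/
noncomputable def wideBlocks {d : ℕ} (M : Finset (Fin (d + 1) → ℕ)) (s : ℕ) (i : Fin (d + 1))
    (j : ℕ) (S : Finset ℕ) : Finset (Fin (d + 1) → ℕ) :=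
  (M.image fun p i => p i / s).filter fun b =>
    b i = j ∧ ∀ v ∈ S, ∃ p ∈ M, (fun i => p i / s) = b ∧ p i = v

/-- Each wide block has a point at every height in `S`, so coordinate `i` can be prescribed freely,
while the blocks themselves order the other coordinates. -/
theorem ContainsPattern.of_wideBlocks {d : ℕ} {P : Type*} [Fintype P] {σ : Fin (d + 1) → P → ℕ}
    {M : Finset (Fin (d + 1) → ℕ)} {s : ℕ} {i : Fin (d + 1)} {j : ℕ} {S : Finset ℕ}
    (hS : Fintype.card P ≤ S.card)
    (h : ContainsPattern (fun l => σ (i.succAbove l))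
      ((wideBlocks M s i j S).image fun b l => b (i.succAbove l))) : ContainsPattern σ M := by
  obtain ⟨φ, hφ, hlt⟩ := h
  obtain ⟨g, hgS, hg⟩ := exists_order_preserving_map_into_finset (σ i) S hS
  have h1 := fun x => Finset.mem_image.1 (hφ x)
  choose b hb hbφ using h1
  have h2 : ∀ x, ∃ p ∈ M, (fun i => p i / s) = b x ∧ p i = g x := fun x =>
    (Finset.mem_filter.1 (hb x)).2.2 _ (hgS x)
  choose ψ hψM hψb hψg using h2
  refine ⟨ψ, hψM, fun l x y hxy => ?_⟩
  rcases eq_or_ne l i with rfl | hl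
  · rw [hψg, hψg]
    exact hg x y hxy
  · obtain ⟨m, rfl⟩ := Fin.exists_succAbove_eq hl
    have h3 := hlt m x y hxy
    rw [← hbφ x, ← hbφ y, ← hψb x, ← hψb y] at h3
    exact lt_of_not_ge fun hle => absurd (Nat.div_le_div_right (c := s) hle) (not_le.2 h3)

theorem card_wideBlocks_image {d : ℕ} (M : Finset (Fin (d + 1) → ℕ)) (s : ℕ) (i : Fin (d + 1))
    (j : ℕ) (S : Finset ℕ) :
    ((wideBlocks M s i j S).image fun b l => b (i.succAbove l)).card
      = (wideBlocks M s i j S).card := by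
  refine Finset.card_image_of_injOn fun b hb b' hb' hbb => ?_
  have h1 := (Finset.mem_filter.1 (Finset.mem_coe.1 hb)).2.1
  have h2 := (Finset.mem_filter.1 (Finset.mem_coe.1 hb')).2.1
  ext l
  rcases eq_or_ne l i with rfl | hl
  · rw [h1, h2]
  · obtain ⟨m, rfl⟩ := Fin.exists_succAbove_eq hl
    exact congrFun hbb m

theorem card_block_le_of_card_image_le {d : ℕ} (B : Finset (Fin d → ℕ)) (k : ℕ)
    (h : ∀ i, (B.image fun p => p i).card ≤ k) : B.card ≤ k ^ d := by
  calc B.card ≤ (Fintype.piFinset fun i => B.image fun p => p i).card := by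
        refine Finset.card_le_card fun p hp => ?_
        rw [Fintype.mem_piFinset]
        exact fun i => Finset.mem_image_of_mem _ hp
    _ = ∏ i, (B.image fun p => p i).card := Fintype.card_piFinset _
    _ ≤ ∏ _i : Fin d, k := Finset.prod_le_prod' fun i _ => h i
    _ = k ^ d := by simp

/-- A block with at most `k` values in each coordinate has at most `k ^ (d + 1)` points. Any other
block is wide for some direction, slab and `k`-set `S`; at most `(d + 1) * N * 2 ^ s` such triples
occur. -/
theorem card_le_thin_add_wide {d : ℕ} (M : Finset (Fin (d + 1) → ℕ)) {s N k w : ℕ} (hs : 0 < s)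
    (hM : ∀ p ∈ M, ∀ i, p i < N * s)
    (hw : ∀ i j S, S.card = k → (wideBlocks M s i j S).card ≤ w) :
    M.card ≤ k ^ (d + 1) * (M.image fun p i => p i / s).card
      + (d + 1) * N * 2 ^ s * w * s ^ (d + 1) := by
  classical
  set M' := M.image fun p (i : Fin (d + 1)) => p i / s with hM'
  let F : (Fin (d + 1) → ℕ) → Finset (Fin (d + 1) → ℕ) := fun b =>
    M.filter fun p => (fun i => p i / s) = b
  let W : Finset (Fin (d + 1) → ℕ) := Finset.univ.biUnion fun i : Fin (d + 1) =>
    (Finset.range N).biUnion fun j =>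
      (((Finset.Ico (j * s) (j * s + s)).powersetCard k).biUnion fun S => wideBlocks M s i j S)
  have himg : ∀ b i, (F b).image (fun p => p i) ⊆ Finset.Ico (b i * s) (b i * s + s) := by
    intro b i v hv
    obtain ⟨p, hp, rfl⟩ := Finset.mem_image.1 hv
    have h1 := congrFun (Finset.mem_filter.1 hp).2 i
    rw [Finset.mem_Ico, ← h1]
    exact ⟨Nat.div_mul_le_self _ _, Nat.lt_div_mul_add hs⟩
  have hall : ∀ b, (F b).card ≤ s ^ (d + 1) := fun b =>
    card_block_le_of_card_image_le _ _ fun i => by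
      simpa using Finset.card_le_card (himg b i)
  have hthin : ∀ b ∈ M', b ∉ W → (F b).card ≤ k ^ (d + 1) := by
    intro b hb hbW
    refine card_block_le_of_card_image_le _ _ fun i => ?_
    by_contra! hlt
    obtain ⟨S, hS, hSk⟩ := Finset.exists_subset_card_eq hlt.le
    refine hbW ?_
    simp only [W, Finset.mem_biUnion, Finset.mem_univ, true_and, Finset.mem_range,
      Finset.mem_powersetCard]
    obtain ⟨p, hp, hpb⟩ := Finset.mem_image.1 hb
    refine ⟨i, b i, ?_, S, ⟨hS.trans (himg b i), hSk⟩, ?_⟩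
    · rw [← hpb]
      exact (Nat.div_lt_iff_lt_mul hs).2 (hM p hp i)
    · refine Finset.mem_filter.2 ⟨hb, rfl, fun v hv => ?_⟩
      obtain ⟨q, hq, hqv⟩ := Finset.mem_image.1 (hS hv)
      exact ⟨q, (Finset.mem_filter.1 hq).1, (Finset.mem_filter.1 hq).2, hqv⟩
  have hWcard : W.card ≤ (d + 1) * N * 2 ^ s * w := by
    calc W.card ≤ (Finset.univ : Finset (Fin (d + 1))).card * (N * (2 ^ s * w)) := by
          refine Finset.card_biUnion_le_card_mul _ _ _ fun i _ => ?_
          refine (Finset.card_biUnion_le_card_mul _ _ (2 ^ s * w) fun j _ => ?_).trans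
            (by simp)
          refine (Finset.card_biUnion_le_card_mul _ _ w fun S hS => ?_).trans ?_
          · exact hw i j S (Finset.mem_powersetCard.1 hS).2
          · refine Nat.mul_le_mul_right _ ?_
            rw [Finset.card_powersetCard]
            refine (Nat.choose_le_two_pow _ _).trans ?_
            simp
      _ = _ := by simp; ring
  have hsum : M.card = ∑ b ∈ M', (F b).card :=
    Finset.card_eq_sum_card_fiberwise fun p hp => Finset.mem_image_of_mem _ hp
  rw [hsum, ← Finset.sum_filter_not_add_sum_filter M' (fun b => b ∈ W)]
  refine Nat.add_le_add ?_ ?_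
  · refine (Finset.sum_le_card_nsmul _ _ (k ^ (d + 1)) fun b hb => ?_).trans ?_
    · exact hthin b (Finset.mem_filter.1 hb).1 (Finset.mem_filter.1 hb).2
    · rw [smul_eq_mul, mul_comm]
      exact Nat.mul_le_mul_left _ (Finset.card_filter_le _ _)
  · refine (Finset.sum_le_card_nsmul _ _ (s ^ (d + 1)) fun b _ => hall b).trans ?_
    rw [smul_eq_mul]
    refine Nat.mul_le_mul_right _ (le_trans (Finset.card_le_card fun b hb => ?_) hWcard)
    exact (Finset.mem_filter.1 hb).2

/-- The Marcus–Tardos theorem in dimension `d + 1`, for grids whose side is a power of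
`2 |P| ^ 2`: a set avoiding a fixed pattern has `O(N ^ d)` points. -/
theorem card_le_of_not_containsPattern (P : Type*) [Fintype P] [Nonempty P] (d : ℕ) :
    ∃ C : ℕ, ∀ (σ : Fin (d + 1) → P → ℕ) (t : ℕ) (M : Finset (Fin (d + 1) → ℕ)),
      (∀ p ∈ M, ∀ i, p i < (2 * Fintype.card P ^ 2) ^ t) → ¬ ContainsPattern σ M →
        M.card ≤ C * ((2 * Fintype.card P ^ 2) ^ t) ^ d := by
  set k := Fintype.card P with hk
  have hk0 : 0 < k := Fintype.card_pos
  set s := 2 * k ^ 2 with hs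
  have hs0 : 0 < s := by positivity
  induction d with
  | zero =>
    refine ⟨k, fun σ t M _ hM => ?_⟩
    rw [pow_zero, mul_one]
    by_contra! hlt
    refine hM ?_
    have hinj : (M.image fun p => p 0).card = M.card :=
      Finset.card_image_of_injective _ fun p q hpq => by
        ext i
        rw [Fin.fin_one_eq_zero i]
        exact hpq
    obtain ⟨g, hg, hlt⟩ := exists_order_preserving_map_into_finset (σ 0) (M.image fun p => p 0)
      (by rw [hinj]; exact hlt.le)
    have := fun x => Finset.mem_image.1 (hg x)
    choose φ hφ hφg using this
    refine ⟨φ, hφ, fun i x y hxy => ?_⟩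
    rw [Fin.fin_one_eq_zero i] at hxy ⊢
    rw [hφg, hφg]
    exact hlt x y hxy
  | succ d ih =>
    obtain ⟨C, hC⟩ := ih
    -- `K - 1` pays for the wide blocks; the `+ 1` covers the one-point grid `t = 0`.
    set K := (d + 2) * 2 ^ s * C * s ^ (d + 2) + 1 with hK
    refine ⟨K, fun σ t => ?_⟩
    induction t with
    | zero =>
      intro M hM _
      have h1 : M ⊆ {0} := fun p hp => by
        rw [Finset.mem_singleton]
        ext i
        simpa using hM p hp i
      have := Finset.card_le_card h1
      simp at this ⊢
      omega
    | succ t iht =>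
      intro M hM hav
      have hwide : ∀ i j S, S.card = k →
          (wideBlocks M s i j S).card ≤ C * (s ^ t) ^ d := by
        intro i j S hS
        rw [← card_wideBlocks_image]
        refine hC (fun l => σ (i.succAbove l)) t _ ?_ fun h => hav (h.of_wideBlocks hS.ge)
        intro q hq l
        obtain ⟨b, hb, rfl⟩ := Finset.mem_image.1 hq
        obtain ⟨p, hp, rfl⟩ := Finset.mem_image.1 (Finset.mem_filter.1 hb).1
        exact (Nat.div_lt_iff_lt_mul hs0).2 (by simpa [pow_succ] using hM p hp _)
      have h1 := card_le_thin_add_wide M (N := s ^ t) (k := k) hs0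
        (fun p hp i => by simpa [pow_succ] using hM p hp i) hwide
      have h2 : (M.image fun p i => p i / s).card ≤ K * (s ^ t) ^ (d + 1) := by
        refine iht _ ?_ fun h => hav h.of_image_div
        intro q hq i
        obtain ⟨p, hp, rfl⟩ := Finset.mem_image.1 hq
        exact (Nat.div_lt_iff_lt_mul hs0).2 (by simpa [pow_succ] using hM p hp i)
      -- The reason for `s = 2 * k ^ 2`: passing to side `s ^ (t + 1)` gains `s ^ (d + 1)`, enough
      -- for the thin factor `k ^ (d + 2)` and one more `K` for the wide blocks.
      have h3 : k ^ (d + 2) + 1 ≤ s ^ (d + 1) := by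
        have h4 : s ^ (d + 1) = 2 ^ (d + 1) * (k ^ (d + 2) * k ^ d) := by
          rw [hs, mul_pow]; ring
        have h5 : 1 ≤ k ^ d := Nat.one_le_pow _ _ hk0
        have h6 : 1 ≤ k ^ (d + 2) := Nat.one_le_pow _ _ hk0
        have h7 : 2 ≤ 2 ^ (d + 1) := by
          rw [pow_succ]; have := Nat.one_le_two_pow (n := d); omega
        calc k ^ (d + 2) + 1 ≤ 2 * (k ^ (d + 2) * 1) := by omega
          _ ≤ s ^ (d + 1) := by rw [h4]; gcongr
      calc M.card ≤ k ^ (d + 2) * (K * (s ^ t) ^ (d + 1))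
            + (d + 2) * s ^ t * 2 ^ s * (C * (s ^ t) ^ d) * s ^ (d + 2) :=
          h1.trans (Nat.add_le_add_right (Nat.mul_le_mul_left _ h2) _)
        _ = (k ^ (d + 2) * K + (K - 1)) * (s ^ t) ^ (d + 1) := by
          rw [hK, Nat.add_sub_cancel]; ring
        _ ≤ ((k ^ (d + 2) + 1) * K) * (s ^ t) ^ (d + 1) := by
          gcongr
          rw [add_mul, one_mul]
          omega
        _ ≤ (s ^ (d + 1) * K) * (s ^ t) ^ (d + 1) := by gcongr
        _ = K * (s ^ (t + 1)) ^ (d + 1) := by ring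

/-! ### Realizers and the grid of sets -/

/-- Every finite nonempty poset has a realizer by as many strictly monotone functions as it has
elements. -/
theorem exists_realizer (P : Type*) [PartialOrder P] [Fintype P] [Nonempty P] :
    ∃ (d : ℕ) (σ : Fin (d + 1) → P → ℕ), (∀ x y, x < y → ∀ i, σ i x < σ i y) ∧
      ∀ x y, ¬ x ≤ y → ∃ i, σ i y < σ i x := by
  classical
  obtain ⟨d, hd⟩ := Nat.exists_eq_succ_of_ne_zero (Fintype.card_ne_zero (α := P))
  let f : Fin (d + 1) ≃ P := (Fintype.equivFinOfCardEq hd).symm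
  let e : P → ℕ := fun w => (Finset.univ.filter fun v => v < w).card
  have he : ∀ x y, x < y → e x < e y := fun x y hxy => by
    refine Finset.card_lt_card ((Finset.ssubset_iff_of_subset ?_).2 ⟨x, by simpa using hxy, by simp⟩)
    intro z hz
    simp only [Finset.mem_filter, Finset.mem_univ, true_and] at hz ⊢
    exact hz.trans hxy
  have hlt : ∀ x, e x < Fintype.card P := fun x => Finset.card_lt_univ_of_notMem (x := x) (by simp)
  -- Lifting the up-set of `f i` above everything else puts `x = f i` above each `y` with `¬ x ≤ y`.
  refine ⟨d, fun i w => e w + if f i ≤ w then Fintype.card P else 0, fun x y hxy i => ?_,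
    fun x y hxy => ⟨f.symm x, ?_⟩⟩
  · have h1 := he x y hxy
    by_cases h : f i ≤ x
    · simp only [h, h.trans hxy.le, if_true]
      omega
    · simp only [h, if_false]
      omega
  · have := hlt y
    simp only [Equiv.apply_symm_apply, hxy, le_refl, if_true, if_false]
    omega

/-- The union of the first `a` elements of `Fin n` and, for each `j`, the `v j` elements from
`a + j * u` on. -/
def gridSet (n a u : ℕ) {d : ℕ} (v : Fin (d + 1) → ℕ) : Finset (Fin n) :=
  Finset.univ.filter fun m => (m : ℕ) < a ∨ ∃ j : Fin (d + 1), a + j * u ≤ m ∧ m < a + j * u + v j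

section gridSet

variable {n a u d : ℕ} {v w : Fin (d + 1) → ℕ}

/-- Only the last interval may be longer than `u`, so the intervals never overlap. -/
theorem add_mul_add_le_of_lt (hv : ∀ j < Fin.last d, v j ≤ u) {i j : Fin (d + 1)} (hij : i < j) :
    a + i * u + v i ≤ a + j * u := by
  have h1 := hv i (hij.trans_le (Fin.le_last j))
  have h2 : ((i : ℕ) + 1) * u ≤ j * u := Nat.mul_le_mul_right _ hij
  rw [add_mul, one_mul] at h2
  omega

theorem add_mul_add_le (hv : ∀ j < Fin.last d, v j ≤ u) (hn : a + d * u + v (Fin.last d) ≤ n)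
    (j : Fin (d + 1)) : a + j * u + v j ≤ n := by
  rcases (Fin.le_last j).lt_or_eq with h | rfl
  · have := add_mul_add_le_of_lt (a := a) hv h
    rw [Fin.val_last] at this
    omega
  · simpa using hn

theorem card_gridSet (hv : ∀ j < Fin.last d, v j ≤ u) (hn : a + d * u + v (Fin.last d) ≤ n) :
    (gridSet n a u v).card = a + ∑ j, v j := by
  have hmap : (gridSet n a u v).map Fin.valEmbedding = Finset.range a ∪
      Finset.univ.biUnion fun j : Fin (d + 1) => Finset.Ico (a + j * u) (a + j * u + v j) := by
    ext m
    simp only [gridSet, Finset.mem_map, Finset.mem_filter, Finset.mem_univ, true_and,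
      Fin.valEmbedding_apply, Finset.mem_union, Finset.mem_range, Finset.mem_biUnion,
      Finset.mem_Ico]
    constructor
    · rintro ⟨m, hm, rfl⟩
      exact hm
    · intro hm
      have hmn : m < n := by
        rcases hm with hm | ⟨j, -, hm⟩
        · have := add_mul_add_le hv hn 0
          omega
        · exact hm.trans_le (add_mul_add_le hv hn j)
      exact ⟨⟨m, hmn⟩, hm, rfl⟩
  rw [← Finset.card_map Fin.valEmbedding, hmap, Finset.card_union_of_disjoint,
    Finset.card_biUnion]
  · simp
  · intro i _ j _ hij
    rw [Function.onFun, Finset.disjoint_left]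
    intro m hm hm'
    rw [Finset.mem_Ico] at hm hm'
    rcases lt_or_gt_of_ne hij with h | h
    · have := add_mul_add_le_of_lt (a := a) hv h
      omega
    · have := add_mul_add_le_of_lt (a := a) hv h
      omega
  · rw [Finset.disjoint_left]
    intro m hm hm'
    simp only [Finset.mem_range, Finset.mem_biUnion, Finset.mem_univ, true_and,
      Finset.mem_Ico] at hm hm'
    obtain ⟨j, hj, -⟩ := hm'
    omega

theorem gridSet_mono (h : v ≤ w) : gridSet n a u v ⊆ gridSet n a u w := by
  intro m hm
  simp only [gridSet, Finset.mem_filter, Finset.mem_univ, true_and] at hm ⊢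
  rcases hm with hm | ⟨j, hj, hj'⟩
  · exact Or.inl hm
  · have : v j ≤ w j := h j
    exact Or.inr ⟨j, hj, by omega⟩

/-- If `w j < v j`, the element `a + j * u + w j` lies in the first set but not in the second. -/
theorem le_of_gridSet_subset (hv : ∀ j < Fin.last d, v j ≤ u)
    (hn : a + d * u + v (Fin.last d) ≤ n) (hw : ∀ j < Fin.last d, w j ≤ u)
    (h : gridSet n a u v ⊆ gridSet n a u w) : v ≤ w := by
  intro j
  change v j ≤ w j
  by_contra! hlt
  have hjn := add_mul_add_le hv hn j
  have hm : (⟨a + j * u + w j, by omega⟩ : Fin n) ∈ gridSet n a u v := by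
    simp only [gridSet, Finset.mem_filter, Finset.mem_univ, true_and]
    exact Or.inr ⟨j, by omega, by omega⟩
  have hm' := h hm
  simp only [gridSet, Finset.mem_filter, Finset.mem_univ, true_and] at hm'
  rcases hm' with hm' | ⟨i, hi, hi'⟩
  · omega
  · rcases lt_trichotomy i j with h | rfl | h
    · have := add_mul_add_le_of_lt (a := a) hw h
      omega
    · omega
    · have := add_mul_add_le_of_lt (a := a) hv h
      omega

end gridSet

/-! ### Averaging over permutations -/

theorem exists_perm_map_eq {α : Type*} [Fintype α] [DecidableEq α] {S T : Finset α}
    (h : S.card = T.card) : ∃ τ : Equiv.Perm α, S.map τ.toEmbedding = T := by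
  let e : {x // x ∈ S} ≃ {x // x ∈ T} := Fintype.equivOfCardEq (by simpa using h)
  refine ⟨e.extendSubtype, Finset.eq_of_subset_of_card_le ?_ (by simp [h])⟩
  intro y hy
  obtain ⟨x, hx, rfl⟩ := Finset.mem_map.1 hy
  exact e.extendSubtype_mem x hx

/-- Left multiplication by a permutation carrying one target to another shows that all targets of
the right size are hit equally often. -/
theorem card_perm_map_eq_mul_choose {n : ℕ} {G S : Finset (Fin n)} (h : S.card = G.card) :
    (Finset.univ.filter fun π : Equiv.Perm (Fin n) => G.map π.toEmbedding = S).card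
      * n.choose G.card = n.factorial := by
  have hsymm : ∀ T ∈ Finset.univ.powersetCard G.card,
      (Finset.univ.filter fun π : Equiv.Perm (Fin n) => G.map π.toEmbedding = T).card
        = (Finset.univ.filter fun π : Equiv.Perm (Fin n) => G.map π.toEmbedding = S).card := by
    intro T hT
    obtain ⟨τ, hτ⟩ := exists_perm_map_eq ((Finset.mem_powersetCard.1 hT).2.trans h.symm)
    refine Finset.card_equiv (Equiv.mulLeft τ) fun π => ?_
    simp only [Finset.mem_filter, Finset.mem_univ, true_and, Equiv.coe_mulLeft]
    have : G.map (τ * π).toEmbedding = (G.map π.toEmbedding).map τ.toEmbedding := by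
      rw [Finset.map_map]
      rfl
    rw [this, ← hτ, Finset.map_inj]
  have hsum : (Finset.univ : Finset (Equiv.Perm (Fin n))).card
      = ∑ T ∈ Finset.univ.powersetCard G.card,
        (Finset.univ.filter fun π : Equiv.Perm (Fin n) => G.map π.toEmbedding = T).card :=
    Finset.card_eq_sum_card_fiberwise fun π _ => by simp
  rw [Finset.sum_congr rfl hsymm, Finset.sum_const, Finset.card_powersetCard, Finset.card_univ,
    Finset.card_univ, Fintype.card_perm, Fintype.card_fin, smul_eq_mul, mul_comm] at hsum
  exact hsum.symm

/-- A uniformly random permutation maps `G` to a uniformly random set of the same size. -/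
theorem card_perm_map_mem {n : ℕ} (A : Finset (Finset (Fin n))) (G : Finset (Fin n)) :
    ((Finset.univ.filter fun π : Equiv.Perm (Fin n) => G.map π.toEmbedding ∈ A).card : ℝ)
      = n.factorial * ∑ S ∈ A.filter (fun S => S.card = G.card), 1 / (n.choose S.card : ℝ) := by
  have h1 : (Finset.univ.filter fun π : Equiv.Perm (Fin n) => G.map π.toEmbedding ∈ A).card
      = ∑ S ∈ A.filter (fun S => S.card = G.card),
        (Finset.univ.filter fun π : Equiv.Perm (Fin n) => G.map π.toEmbedding = S).card := by
    rw [Finset.card_eq_sum_card_fiberwise (f := fun π : Equiv.Perm (Fin n) => G.map π.toEmbedding)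
      (t := A.filter fun S => S.card = G.card) fun π hπ => by simpa using hπ]
    refine Finset.sum_congr rfl fun S hS => ?_
    rw [Finset.filter_filter]
    congr 1
    ext π
    simp only [Finset.mem_filter, Finset.mem_univ, true_and, and_iff_right_iff_imp]
    rintro rfl
    exact (Finset.mem_filter.1 hS).1
  rw [h1, Nat.cast_sum, Finset.mul_sum]
  refine Finset.sum_congr rfl fun S hS => ?_
  have hcard := (Finset.mem_filter.1 hS).2
  have hle : G.card ≤ n := by simpa using Finset.card_le_univ G
  have hpos : (0 : ℝ) < n.choose G.card := by exact_mod_cast Nat.choose_pos hle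
  rw [hcard, mul_one_div, eq_div_iff hpos.ne']
  exact_mod_cast card_perm_map_eq_mul_choose hcard

/-! ### Grid points on prescribed levels and the window bound -/

/-- The grid point with first coordinates `v` and coordinate sum `l`. -/
def completePoint {d : ℕ} (l : ℕ) (v : Fin d → ℕ) : Fin (d + 1) → ℕ :=
  Fin.snoc v (l - ∑ i, v i)

theorem sum_le_mul_of_forall_lt {d u : ℕ} {v : Fin d → ℕ} (hv : ∀ i, v i < u) :
    ∑ i, v i ≤ d * u := by
  simpa using Finset.sum_le_card_nsmul Finset.univ v u fun i _ => (hv i).le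

theorem completePoint_le {d u l : ℕ} {v : Fin d → ℕ} (hv : ∀ i, v i < u) (j : Fin (d + 1))
    (hj : j < Fin.last d) : completePoint l v j ≤ u := by
  obtain ⟨i, rfl⟩ := Fin.exists_castSucc_eq.2 hj.ne
  simpa [completePoint] using (hv i).le

theorem completePoint_last_le {d l : ℕ} (v : Fin d → ℕ) :
    completePoint l v (Fin.last d) ≤ l := by
  simp [completePoint]

theorem sum_completePoint {d l : ℕ} {v : Fin d → ℕ} (hv : ∑ i, v i ≤ l) :
    ∑ j, completePoint l v j = l := by
  rw [Fin.sum_univ_castSucc]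
  simp only [completePoint, Fin.snoc_castSucc, Fin.snoc_last]
  omega

theorem completePoint_injective {d l l' : ℕ} {v v' : Fin d → ℕ} (hv : ∑ i, v i ≤ l)
    (hv' : ∑ i, v' i ≤ l') (h : completePoint l v = completePoint l' v') : v = v' ∧ l = l' := by
  refine ⟨?_, ?_⟩
  · have := congrArg Fin.init h
    simpa [completePoint] using this
  · rw [← sum_completePoint hv, ← sum_completePoint hv', h]

theorem isInducedSubposet_of_containsPattern {P : Type*} [PartialOrder P] {n a u d : ℕ}
    {σ : Fin (d + 1) → P → ℕ} (hmono : ∀ x y, x < y → ∀ i, σ i x < σ i y)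
    (hreal : ∀ x y, ¬ x ≤ y → ∃ i, σ i y < σ i x) {A : Finset (Finset (Fin n))}
    {M : Finset (Fin (d + 1) → ℕ)} (π : Equiv.Perm (Fin n))
    (hM : ∀ p ∈ M, (gridSet n a u p).map π.toEmbedding ∈ A ∧ (∀ j < Fin.last d, p j ≤ u) ∧
      a + d * u + p (Fin.last d) ≤ n)
    (h : ContainsPattern σ M) : IsInducedSubposet P A := by
  obtain ⟨φ, hφ, hlt⟩ := h
  have key : ∀ x y, x ≤ y ↔ (gridSet n a u (φ x)).map π.toEmbedding ⊆
      (gridSet n a u (φ y)).map π.toEmbedding := by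
    intro x y
    rw [Finset.map_subset_map]
    constructor
    · intro hxy
      refine gridSet_mono fun i => ?_
      rcases hxy.lt_or_eq with hxy | rfl
      · exact (hlt i x y (hmono x y hxy i)).le
      · exact le_rfl
    · intro hsub
      by_contra hxy
      obtain ⟨i, hi⟩ := hreal x y hxy
      have h1 : φ x i ≤ φ y i :=
        le_of_gridSet_subset (hM _ (hφ x)).2.1 (hM _ (hφ x)).2.2 (hM _ (hφ y)).2.1 hsub i
      have h2 := hlt i y x hi
      omega
  refine ⟨fun x => (gridSet n a u (φ x)).map π.toEmbedding, fun x y hxy => ?_,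
    fun x => (hM _ (hφ x)).1, key⟩
  exact le_antisymm ((key x y).2 hxy.le) ((key y x).2 hxy.ge)

theorem lubell_eq_sum_levels {n : ℕ} {A : Finset (Finset (Fin n))} {T : Finset ℕ}
    (h : ∀ S ∈ A, S.card ∈ T) :
    lubell A = ∑ s ∈ T, ∑ S ∈ A.filter (fun S => S.card = s), 1 / (n.choose S.card : ℝ) :=
  (Finset.sum_fiberwise_of_maps_to h _).symm

/-- An induced `P`-free family living on `u + 1` consecutive levels which are at distance at least
a fixed multiple of `u` from the bottom and from the top has bounded Lubell function. -/
theorem exists_lubell_le_of_window (P : Type*) [PartialOrder P] [Fintype P] [Nonempty P] :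
    ∃ (d : ℕ) (C : ℝ), 0 ≤ C ∧ ∀ n u x : ℕ, 0 < u → d * u ≤ x → x + (d + 1) * u ≤ n →
      ∀ A : Finset (Finset (Fin n)), InducedFree P A → (∀ S ∈ A, x ≤ S.card ∧ S.card ≤ x + u) →
        lubell A ≤ C := by
  obtain ⟨d, σ, hmono, hreal⟩ := exists_realizer P
  obtain ⟨C, hC⟩ := card_le_of_not_containsPattern P d
  set s := 2 * Fintype.card P ^ 2 with hs
  have hs2 : 1 < s := by
    have := Nat.one_le_pow 2 (Fintype.card P) Fintype.card_pos
    omega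
  refine ⟨d, C * (s * (d + 2)) ^ d, by positivity, fun n u x hu hx hxn A hA hAx => ?_⟩
  obtain ⟨a, rfl⟩ : ∃ a, x = a + d * u := ⟨x - d * u, by omega⟩
  have hdu : (d + 1) * u = d * u + u := by ring
  -- All coordinates are at most `(d + 1) * u`; the least power of `s` beyond this overshoots by a
  -- factor of at most about `s`.
  set t := Nat.clog s ((d + 1) * u + 1) with ht
  have hside : (d + 1) * u < s ^ t := Nat.le_pow_clog hs2 _
  have hside' : s ^ t ≤ s * (d + 2) * u := by
    have h1 : 1 < (d + 1) * u + 1 := by omega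
    have h2 := Nat.pow_pred_clog_lt_self hs2 h1
    have h3 : 0 < t := Nat.clog_pos hs2 h1
    have h4 : s ^ t = s * s ^ (t - 1) := by
      rw [← pow_succ', Nat.sub_add_cancel h3]
    rw [h4, mul_assoc s]
    refine Nat.mul_le_mul_left _ ?_
    have h5 : (d + 2) * u = (d + 1) * u + u := by ring
    rw [Nat.pred_eq_sub_one, ← ht] at h2
    omega
  -- A level offset and `d` free coordinates. The last coordinate is forced by the level; as the
  -- free ones sum to at most `d * u`, truncated subtraction loses nothing and every level gets
  -- exactly `u ^ d` points.
  let Q : Finset (ℕ × (Fin d → ℕ)) :=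
    Finset.range (u + 1) ×ˢ Fintype.piFinset fun _ => Finset.range u
  let pt : ℕ × (Fin d → ℕ) → Fin (d + 1) → ℕ := fun q => completePoint (d * u + q.1) q.2
  have hQ : ∀ q ∈ Q, q.1 ≤ u ∧ ∀ i, q.2 i < u := fun q hq => by
    simp only [Q, Finset.mem_product, Finset.mem_range, Fintype.mem_piFinset] at hq
    exact ⟨by omega, hq.2⟩
  have hQsum : ∀ q ∈ Q, ∑ i, q.2 i ≤ d * u + q.1 := fun q hq =>
    (sum_le_mul_of_forall_lt (hQ q hq).2).trans (Nat.le_add_right _ _)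
  have hpt : ∀ q ∈ Q, (∀ j < Fin.last d, pt q j ≤ u) ∧ pt q (Fin.last d) ≤ d * u + u :=
    fun q hq => ⟨completePoint_le (hQ q hq).2,
      (completePoint_last_le _).trans (Nat.add_le_add_left (hQ q hq).1 _)⟩
  have hcard : ∀ q ∈ Q, (gridSet n a u (pt q)).card = a + d * u + q.1 := fun q hq => by
    have := (hpt q hq).2
    rw [card_gridSet (hpt q hq).1 (by omega), sum_completePoint (hQsum q hq), add_assoc]
  have hupper : ∀ π : Equiv.Perm (Fin n),
      (Q.filter fun q => (gridSet n a u (pt q)).map π.toEmbedding ∈ A).card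
        ≤ C * (s ^ t) ^ d := by
    intro π
    rw [← Finset.card_image_of_injOn (f := pt)]
    · refine hC σ t _ ?_ fun h => hA
        (isInducedSubposet_of_containsPattern (a := a) (u := u) hmono hreal π ?_ h)
      · intro p hp j
        obtain ⟨q, hq, rfl⟩ := Finset.mem_image.1 hp
        have h1 := hpt q (Finset.mem_filter.1 hq).1
        rcases (Fin.le_last j).lt_or_eq with hj | rfl
        · have := h1.1 j hj
          omega
        · omega
      · intro p hp
        obtain ⟨q, hq, rfl⟩ := Finset.mem_image.1 hp
        obtain ⟨hq, hqA⟩ := Finset.mem_filter.1 hq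
        have h1 := hpt q hq
        exact ⟨hqA, h1.1, by omega⟩
    · intro q hq q' hq' h
      have h1 := completePoint_injective (hQsum q (Finset.mem_filter.1 hq).1)
        (hQsum q' (Finset.mem_filter.1 hq').1) h
      exact Prod.ext (by omega) h1.1
  -- Count pairs of a permutation and a grid point in both orders.
  have hdouble : ∑ π : Equiv.Perm (Fin n),
      ((Q.filter fun q => (gridSet n a u (pt q)).map π.toEmbedding ∈ A).card : ℝ)
        = n.factorial * (u ^ d * lubell A) := by
    have h1 : ∑ π : Equiv.Perm (Fin n),
        (Q.filter fun q => (gridSet n a u (pt q)).map π.toEmbedding ∈ A).card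
        = ∑ q ∈ Q, (Finset.univ.filter fun π : Equiv.Perm (Fin n) =>
          (gridSet n a u (pt q)).map π.toEmbedding ∈ A).card := by
      simp only [Finset.card_filter]
      exact Finset.sum_comm
    rw [← Nat.cast_sum, h1, Nat.cast_sum]
    have h2 : ∀ q ∈ Q, ((Finset.univ.filter fun π : Equiv.Perm (Fin n) =>
          (gridSet n a u (pt q)).map π.toEmbedding ∈ A).card : ℝ)
        = n.factorial * ∑ S ∈ A.filter (fun S => S.card = a + d * u + q.1),
          1 / (n.choose S.card : ℝ) := fun q hq => by
      rw [card_perm_map_mem, hcard q hq]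
    rw [Finset.sum_congr rfl h2, ← Finset.mul_sum, Finset.sum_product]
    congr 1
    simp only [Finset.sum_const, Fintype.card_piFinset, Finset.card_range, Finset.prod_const,
      Finset.card_univ, Fintype.card_fin, nsmul_eq_mul, Nat.cast_pow]
    rw [← Finset.mul_sum]
    congr 1
    have hinj : Set.InjOn (fun r => a + d * u + r) (Finset.range (u + 1) : Set ℕ) :=
      fun r _ r' _ h => Nat.add_left_cancel h
    rw [lubell_eq_sum_levels (T := (Finset.range (u + 1)).image fun r => a + d * u + r),
      Finset.sum_image hinj]
    intro S hS
    have := hAx S hS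
    exact Finset.mem_image.2 ⟨S.card - (a + d * u), by rw [Finset.mem_range]; omega, by omega⟩
  have hfin : (n.factorial : ℝ) * (u ^ d * lubell A)
      ≤ n.factorial * (u ^ d * (C * (s * (d + 2)) ^ d)) := by
    rw [← hdouble]
    calc _ ≤ ∑ _π : Equiv.Perm (Fin n), ((C * (s * (d + 2) * u) ^ d : ℕ) : ℝ) := by
          refine Finset.sum_le_sum fun π _ => Nat.cast_le.2 ((hupper π).trans ?_)
          gcongr
      _ = _ := by
          rw [Finset.sum_const, Finset.card_univ, Fintype.card_perm, Fintype.card_fin,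
            nsmul_eq_mul]
          push_cast
          rw [mul_pow _ (u : ℝ)]
          ring
  have hn0 : (0 : ℝ) < n.factorial := by positivity
  have hu0 : (0 : ℝ) < (u : ℝ) ^ d := by positivity
  exact le_of_mul_le_mul_left (le_of_mul_le_mul_left hfin hn0) hu0

/-! ### Cutting the levels into windows -/

theorem lubell_le_card_levels {n : ℕ} {A : Finset (Finset (Fin n))} {T : Finset ℕ}
    (h : ∀ S ∈ A, S.card ∈ T) : lubell A ≤ T.card := by
  rw [lubell_eq_sum_levels h]
  calc _ ≤ ∑ _s ∈ T, (1 : ℝ) := by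
        refine Finset.sum_le_sum fun s _ => ?_
        have h1 : ∀ S ∈ A.filter (fun S => S.card = s),
            1 / (n.choose S.card : ℝ) = 1 / (n.choose s : ℝ) := fun S hS => by
          rw [(Finset.mem_filter.1 hS).2]
        have h2 : (A.filter fun S => S.card = s).card ≤ n.choose s := by
          have h3 : A.filter (fun S => S.card = s) ⊆ Finset.univ.powersetCard s := fun S hS => by
            simpa using (Finset.mem_filter.1 hS).2
          simpa using Finset.card_le_card h3
        rw [Finset.sum_congr rfl h1, Finset.sum_const, nsmul_eq_mul, mul_one_div]
        exact div_le_one_of_le₀ (by exact_mod_cast h2) (by positivity)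
    _ = T.card := by simp

theorem lubell_filter_add_lubell_filter_not {n : ℕ} (A : Finset (Finset (Fin n)))
    (p : Finset (Fin n) → Prop) [DecidablePred p] :
    lubell (A.filter p) + lubell (A.filter fun S => ¬ p S) = lubell A :=
  Finset.sum_filter_add_sum_filter_not A p _

theorem InducedFree.mono {P : Type*} [PartialOrder P] {n : ℕ} {A B : Finset (Finset (Fin n))}
    (hA : InducedFree P A) (h : B ⊆ A) : InducedFree P B :=
  fun ⟨φ, h1, h2, h3⟩ => hA ⟨φ, h1, fun x => h (h2 x), h3⟩

theorem not_inducedFree_of_isEmpty {P : Type*} [PartialOrder P] [IsEmpty P] {n : ℕ}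
    (A : Finset (Finset (Fin n))) : ¬ InducedFree P A :=
  fun h => h ⟨isEmptyElim, fun x => isEmptyElim x, fun x => isEmptyElim x, fun x => isEmptyElim x⟩

/-- The Lubell function of an induced `P`-free family on levels `a, …, b` is `O(√(b - a))`. -/
theorem exists_lubell_le_mul_sqrt (P : Type*) [PartialOrder P] [Finite P] :
    ∃ C : ℝ, 0 ≤ C ∧ ∀ n a b : ℕ, a < b → b ≤ n → ∀ A : Finset (Finset (Fin n)),
      InducedFree P A → (∀ S ∈ A, a ≤ S.card ∧ S.card ≤ b) →
        lubell A ≤ C * Nat.sqrt (b - a) := by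
  cases isEmpty_or_nonempty P with
  | inl h => exact ⟨0, le_rfl, fun n a b _ _ A hA => absurd hA (not_inducedFree_of_isEmpty A)⟩
  | inr h =>
  have := Fintype.ofFinite P
  obtain ⟨d, C, hC0, hC⟩ := exists_lubell_le_of_window P
  -- `d * u` low and `(d + 1) * u` high levels at 1 each, and at most `5 * u` windows at `C` each.
  refine ⟨(2 * d + 1) + 5 * C, by positivity, fun n a b hab hbn A hA hAab => ?_⟩
  set u := Nat.sqrt (b - a) with hu
  have hu0 : 0 < u := Nat.sqrt_pos.2 (by omega)
  have hdu : (d + 1) * u = d * u + u := by ring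
  let mid := (A.filter fun S => ¬ S.card < d * u).filter fun S => ¬ n < S.card + (d + 1) * u
  have hlow : lubell (A.filter fun S => S.card < d * u) ≤ d * u := by
    have := lubell_le_card_levels (A := A.filter fun S => S.card < d * u)
      (T := Finset.range (d * u)) fun S hS => by simpa using (Finset.mem_filter.1 hS).2
    simpa using this
  have hhigh : lubell ((A.filter fun S => ¬ S.card < d * u).filter
      fun S => n < S.card + (d + 1) * u) ≤ (d + 1) * u := by
    refine (lubell_le_card_levels (T := Finset.Ico (n + 1 - (d + 1) * u) (n + 1)) fun S hS => ?_).trans ?_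
    · have h1 := (Finset.mem_filter.1 hS).2
      have h2 : S.card ≤ n := by simpa using Finset.card_le_univ S
      rw [Finset.mem_Ico]
      omega
    · rw [Nat.card_Ico]
      have : n + 1 - (n + 1 - (d + 1) * u) ≤ (d + 1) * u := by omega
      exact_mod_cast this
  have hmidA : mid ⊆ A := (Finset.filter_subset _ _).trans (Finset.filter_subset _ _)
  have hmid : lubell mid ≤ 5 * u * C := by
    have hmaps : ∀ S ∈ mid, S.card / u ∈ Finset.Icc (a / u) (b / u) := fun S hS => by
      rw [Finset.mem_Icc]
      have := hAab S (hmidA hS)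
      exact ⟨Nat.div_le_div_right this.1, Nat.div_le_div_right this.2⟩
    have hsum : lubell mid = ∑ q ∈ Finset.Icc (a / u) (b / u),
        lubell (mid.filter fun S => S.card / u = q) :=
      (Finset.sum_fiberwise_of_maps_to hmaps _).symm
    have hwin : ∀ q ∈ Finset.Icc (a / u) (b / u),
        lubell (mid.filter fun S => S.card / u = q) ≤ C := by
      intro q _
      -- A member of the window certifies its distance from bottom and top; an empty window
      -- contributes 0.
      rcases (mid.filter fun S => S.card / u = q).eq_empty_or_nonempty with h0 | ⟨S, hS⟩
      · rw [h0]
        simpa [lubell] using hC0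
      obtain ⟨hSm, hSq⟩ := Finset.mem_filter.1 hS
      obtain ⟨hSm, hS2⟩ := Finset.mem_filter.1 hSm
      obtain ⟨-, hS1⟩ := Finset.mem_filter.1 hSm
      have hdq : d ≤ q := by
        rw [← hSq, Nat.le_div_iff_mul_le hu0]
        omega
      have hq : q * u ≤ S.card := by
        rw [← hSq]
        exact Nat.div_mul_le_self _ _
      refine hC n u (q * u) hu0 (Nat.mul_le_mul_right _ hdq) (by omega) _
        (hA.mono ((Finset.filter_subset _ _).trans hmidA)) fun T hT => ?_
      have hTq := (Finset.mem_filter.1 hT).2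
      rw [← hTq]
      exact ⟨Nat.div_mul_le_self _ _, (Nat.lt_div_mul_add hu0).le⟩
    -- At most `u + 4` windows, since `b - a < (u + 1) ^ 2`; then `u ≥ 1` is used.
    have hcount : (Finset.Icc (a / u) (b / u)).card ≤ 5 * u := by
      have h1 : b - a < (u + 1) * (u + 1) := Nat.lt_succ_sqrt _
      have h2 : b < a / u * u + u + (u * u + 2 * u + 1) := by
        have := Nat.lt_div_mul_add (a := a) hu0
        have h3 : (u + 1) * (u + 1) = u * u + 2 * u + 1 := by ring
        omega
      have h4 : b / u < a / u + (u + 4) := by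
        rw [Nat.div_lt_iff_lt_mul hu0]
        have : (a / u + (u + 4)) * u = a / u * u + u * u + 4 * u := by ring
        omega
      rw [Nat.card_Icc]
      omega
    rw [hsum]
    refine (Finset.sum_le_card_nsmul _ _ C hwin).trans ?_
    rw [nsmul_eq_mul]
    refine mul_le_mul_of_nonneg_right ?_ hC0
    exact_mod_cast hcount
  rw [← lubell_filter_add_lubell_filter_not A fun S => S.card < d * u,
    ← lubell_filter_add_lubell_filter_not (A.filter fun S => ¬ S.card < d * u)
      fun S => n < S.card + (d + 1) * u]
  linarith

theorem natSqrt_le_rpow {w : ℕ} (hw : 0 < w) {c : ℝ} (hc : 1 / 2 ≤ c) :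
    (Nat.sqrt w : ℝ) ≤ (w : ℝ) ^ c := by
  calc (Nat.sqrt w : ℝ) ≤ Real.sqrt w := Real.nat_sqrt_le_real_sqrt
    _ = (w : ℝ) ^ (1 / 2 : ℝ) := Real.sqrt_eq_rpow _
    _ ≤ (w : ℝ) ^ c := Real.rpow_le_rpow_of_exponent_le (by exact_mod_cast hw) hc

theorem theorem7 (P : Type*) [PartialOrder P] [Finite P] (c : ℝ) (hc : 1 / 2 < c) :
    ((fun n : ℕ => lubellMax n P) =O[atTop] fun n : ℕ => (n : ℝ) ^ c) ∧
    ∃ C : ℝ, ∀ n a b : ℕ, a < b → b ≤ n → ∀ A : Finset (Finset (Fin n)),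
      InducedFree P A → (∀ S ∈ A, a ≤ S.card ∧ S.card ≤ b) →
        lubell A ≤ C * ((b : ℝ) - (a : ℝ)) ^ c := by
  obtain ⟨C, hC0, hC⟩ := exists_lubell_le_mul_sqrt P
  have hrange : ∀ n a b : ℕ, a < b → b ≤ n → ∀ A : Finset (Finset (Fin n)),
      InducedFree P A → (∀ S ∈ A, a ≤ S.card ∧ S.card ≤ b) →
        lubell A ≤ C * ((b : ℝ) - (a : ℝ)) ^ c := by
    intro n a b hab hbn A hA hAab
    refine (hC n a b hab hbn A hA hAab).trans (mul_le_mul_of_nonneg_left ?_ hC0)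
    rw [← Nat.cast_sub hab.le]
    exact natSqrt_le_rpow (by omega) hc.le
  refine ⟨IsBigO.of_bound C ?_, C, hrange⟩
  filter_upwards [eventually_gt_atTop 0] with n hn
  have h0 : 0 ≤ lubellMax n P := by
    refine Real.sSup_nonneg ?_
    rintro _ ⟨A, -, rfl⟩
    exact Finset.sum_nonneg fun S _ => by positivity
  rw [Real.norm_of_nonneg h0, Real.norm_of_nonneg (by positivity)]
  -- For empty `P` the set is empty and its `sSup` is 0, so a nonnegative bound covers this case
  -- too.
  refine Real.sSup_le ?_ (by positivity)
  rintro _ ⟨A, hA, rfl⟩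
  simpa using hrange n 0 n hn le_rfl A hA fun S _ =>
    ⟨Nat.zero_le _, by simpa using Finset.card_le_univ S⟩
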